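/- Let $\mathcal M$ be a smooth connected manifold (Hausdorff, second countable, of dimension $n$, without boundary) with a smooth Riemannian metric $\mathrm h$. For $x,y\in\mathcal M$ let $$\mathrm d_{\mathrm{Riem},\mathrm h}(x,y)=\inf\Big\{\int_a^b|\gamma'(t)|_{\mathrm h(\gamma(t))}\,dt:\ \gamma:[a,b]\to\mathcal M\ \text{piecewise smooth},\ \gamma(a)=x,\ \gamma(b)=y\Big\}$$ be the Riemannian path-length distance, and let $$\mathrm d_{\mathrm h}(x,y)=\sup\big\{w(y)-w(x):\ w:\mathcal M\to\mathbb R\ \text{locally Lipschitz},\ |\nabla w|_{\mathrm h^{-1}}\le 1\ \text{almost everywhere}\big\}$$ be the Lipschitz-dual distance. Here $w$ is locally Lipschitz, and a property holds almost everywhere, if this is so in every chart (with respect to Lebesgue measure); $\nabla w=\mathrm dw$ is the differential of $w$, which exists almost everywhere; and $|\xi|_{\mathrm h^{-1}}=\big(\sum_{i,j}\mathrm h^{ij}\xi_i\xi_j\big)^{1/2}$ with $(\mathrm h^{ij})=(\mathrm h_{ij})^{-1}$ in local coordinates. Then $\mathrm d_{\mathrm{Riem},\mathrm h}(x,y)=\mathrm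 d_{\mathrm h}(x,y)<\infty$ for all $x,y\in\mathcal M$. -/

import Mathlib

open scoped Manifold ContDiff ENNReal
open MeasureTheory Set

noncomputable section

namespace LipschitzDual

/-- A smooth Riemannian metric on an `n`-dimensional smooth manifold `M` without boundary:
a smooth section `x ↦ h.inner x` of the bundle of bilinear forms on the tangent spaces which is
symmetric and positive definite at every point. -/
abbrev SmoothMetric (n : ℕ) (M : Type*) [TopologicalSpace M]
    [ChartedSpace (EuclideanSpace ℝ (Fin n)) M] [IsManifold (𝓡 n) ∞ M] :=
  Bundle.ContMDiffRiemannianMetric (𝓡 n) ∞ (EuclideanSpace ℝ (Fin n))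
    (fun x : M => TangentSpace (𝓡 n) x)

variable {n : ℕ} {M : Type*} [TopologicalSpace M] [ChartedSpace (EuclideanSpace ℝ (Fin n)) M]

/-! ### The path-length distance -/

/-- `γ` restricts to a piecewise smooth curve on `[a, b]`: there are finitely many break points
`a = t 0 ≤ t 1 ≤ ⋯ ≤ t N = b` such that `γ` is smooth (up to the end points) on each closed interval
`[t i, t (i + 1)]`. In particular `a ≤ b`, and `γ` is continuous on `[a, b]`. -/
def IsPiecewiseSmooth (n : ℕ) {M : Type*} [TopologicalSpace M]
    [ChartedSpace (EuclideanSpace ℝ (Fin n)) M] (γ : ℝ → M) (a b : ℝ) : Prop :=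
  ∃ (N : ℕ) (t : ℕ → ℝ), Monotone t ∧ t 0 = a ∧ t N = b ∧
    ∀ i < N, ContMDiffOn 𝓘(ℝ, ℝ) (𝓡 n) ∞ γ (Icc (t i) (t (i + 1)))

/-- The velocity `γ'(t)`. It only matters away from the finitely many break points. -/
def velocity (n : ℕ) {M : Type*} [TopologicalSpace M]
    [ChartedSpace (EuclideanSpace ℝ (Fin n)) M] (γ : ℝ → M) (t : ℝ) :
    TangentSpace (𝓡 n) (γ t) :=
  mfderiv 𝓘(ℝ, ℝ) (𝓡 n) γ t (1 : ℝ)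

/-- The `h`-length `∫ₐᵇ |γ'(t)|_{h(γ(t))} dt`. -/
def curveLength [IsManifold (𝓡 n) ∞ M] (h : SmoothMetric n M) (γ : ℝ → M) (a b : ℝ) : ℝ≥0∞ :=
  ∫⁻ t in Icc a b,
    ENNReal.ofReal (Real.sqrt (h.inner (γ t) (velocity n γ t) (velocity n γ t)))

/-- The Riemannian distance: the infimum of the lengths of the piecewise smooth curves
from `x` to `y`, in the extended reals. -/
def riemDist [IsManifold (𝓡 n) ∞ M] (h : SmoothMetric n M) (x y : M) : EReal :=
  ⨅ (γ : ℝ → M) (a : ℝ) (b : ℝ) (_ : IsPiecewiseSmooth n γ a b) (_ : γ a = x) (_ : γ b = y),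
    ((curveLength h γ a b : ℝ≥0∞) : EReal)

/-! ### The Lipschitz-dual distance -/

/-- `w` is locally Lipschitz: it is so in every chart. -/
def IsLocLipschitz (n : ℕ) {M : Type*} [TopologicalSpace M]
    [ChartedSpace (EuclideanSpace ℝ (Fin n)) M] (w : M → ℝ) : Prop :=
  ∀ e ∈ atlas (EuclideanSpace ℝ (Fin n)) M, LocallyLipschitzOn e.target (w ∘ e.symm)

/-- `P` holds almost everywhere on the smooth manifold `M`: in every chart it holds outside a set
of Lebesgue measure zero. -/
def AlmostEverywhere (n : ℕ) {M : Type*} [TopologicalSpace M]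
    [ChartedSpace (EuclideanSpace ℝ (Fin n)) M] (P : M → Prop) : Prop :=
  ∀ e ∈ atlas (EuclideanSpace ℝ (Fin n)) M,
    ∀ᵐ z ∂((volume : Measure (EuclideanSpace ℝ (Fin n))).restrict e.target), P (e.symm z)

/-- The `i`-th vector of the coordinate frame at `x` of the preferred chart at `x` (through which
Mathlib identifies the tangent space at `x` with `ℝⁿ`). -/
def coordVector (x : M) (i : Fin n) : TangentSpace (𝓡 n) x :=
  (EuclideanSpace.single i (1 : ℝ) : EuclideanSpace ℝ (Fin n))

/-- The matrix `(h_{ij}(x))` of `h` at `x` in the coordinate frame. -/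
def metricMatrix [IsManifold (𝓡 n) ∞ M] (h : SmoothMetric n M) (x : M) :
    Matrix (Fin n) (Fin n) ℝ :=
  Matrix.of fun i j => h.inner x (coordVector x i) (coordVector x j)

/-- The norm `|ξ|_{h⁻¹(x)} = (∑ h^{ij}(x) ξ_i ξ_j)^{1/2}` of a covector `ξ` at `x`, where `(h^{ij})`
is the inverse of the matrix `(h_{ij})`. The value does not depend on the frame. -/
def coNorm [IsManifold (𝓡 n) ∞ M] (h : SmoothMetric n M) (x : M)
    (ξ : TangentSpace (𝓡 n) x →L[ℝ] ℝ) : ℝ :=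
  Real.sqrt (∑ i, ∑ j, (metricMatrix h x)⁻¹ i j * ξ (coordVector x i) * ξ (coordVector x j))

/-- The differential of a function at a point, as a covector. -/
def differential (w : M → ℝ) (x : M) : TangentSpace (𝓡 n) x →L[ℝ] ℝ :=
  mfderiv (𝓡 n) 𝓘(ℝ, ℝ) w x

/-- `w` is locally Lipschitz and `|∇w|_{h⁻¹} ≤ 1` almost everywhere. -/
def IsAdmissible [IsManifold (𝓡 n) ∞ M] (h : SmoothMetric n M) (w : M → ℝ) : Prop :=
  IsLocLipschitz n w ∧
    AlmostEverywhere n fun x : M =>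
      MDifferentiableAt (𝓡 n) 𝓘(ℝ, ℝ) w x ∧ coNorm h x (differential w x) ≤ 1

/-- The Lipschitz-dual distance: the supremum of `w y - w x` over all admissible `w`,
in the extended reals. -/
def lipDist [IsManifold (𝓡 n) ∞ M] (h : SmoothMetric n M) (x y : M) : EReal :=
  ⨆ (w : M → ℝ) (_ : IsAdmissible h w), ((w y - w x : ℝ) : EReal)

end LipschitzDual

end

/-! Both inequalities pass through one class of functions. Call `w` locally short (`IsLocallyShort`)
if near each `x₀`, for every `r > 1`, its increments are at most `r` times the length of the
coordinate increment in the metric frozen at `x₀`. This condition involves no null sets, and letting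
`r` tend to 1 recovers the sharp bound on derivatives.

Locally short and admissible are equivalent. An admissible function is short because, by Fubini,
almost every translate of a chart segment meets the exceptional null set in measure zero;
integration along such translates and continuity give the bound (`sub_le_of_ae_fderiv_le`,
`IsAdmissible.isLocallyShort`). The converse is Rademacher's theorem plus duality of norms
(`IsLocallyShort.isAdmissible`).

A short function grows along a curve by at most its length, even if the curve lies in the
exceptional set; hence `lipDist_le_riemDist`. Conversely, extending curves by small chart segments
shows that the Riemannian distance from `x`, finite by connectedness, is locally short
(`isLocallyShort_riemDist`). It is thus an admissible competitor that attains the supremum. -/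

open Filter Topology

noncomputable section

namespace LipschitzDual

/-! ### Increments from an almost everywhere bound on the differential -/

/-- A function on a ball that is Lipschitz and whose differential is almost everywhere
bounded by `N` has increments bounded by `N`. -/
theorem sub_le_of_ae_fderiv_le {E : Type*} [NormedAddCommGroup E] [NormedSpace ℝ E]
    [FiniteDimensional ℝ E] [MeasurableSpace E] [BorelSpace E] (μ : Measure E)
    [μ.IsAddHaarMeasure] {W : E → ℝ} {N : E → ℝ} {K : NNReal} {c : E} {δ : ℝ}
    (hW : LipschitzOnWith K W (Metric.ball c δ))
    (hN : ∀ᵐ z ∂μ, z ∈ Metric.ball c δ → DifferentiableAt ℝ W z ∧ ∀ v, fderiv ℝ W z v ≤ N v)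
    {p q : E} (hp : p ∈ Metric.ball c δ) (hq : q ∈ Metric.ball c δ) :
    W q - W p ≤ N (q - p) := by
  set B := Metric.ball c δ with hB
  have hBo : IsOpen B := Metric.isOpen_ball
  set u := q - p with hu
  -- A measurable null superset of the exceptional set, as the exchange of quantifiers below needs
  -- measurability.
  set bad := toMeasurable μ
    {z | ¬ (z ∈ B → DifferentiableAt ℝ W z ∧ ∀ v, fderiv ℝ W z v ≤ N v)} with hbad
  have hbad0 : μ bad = 0 := by rw [hbad, measure_toMeasurable]; exact hN
  have hbadm : MeasurableSet bad := measurableSet_toMeasurable _ _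
  have hgood : ∀ z ∉ bad, z ∈ B → DifferentiableAt ℝ W z ∧ ∀ v, fderiv ℝ W z v ≤ N v := by
    intro z hz
    by_contra hcon
    exact hz (subset_toMeasurable _ _ hcon)
  have h1 : ∀ᵐ t : ℝ, ∀ᵐ v ∂μ, v + t • u ∉ bad := by
    refine Eventually.of_forall fun t => ?_
    have := (measurePreserving_add_right μ (t • u)).quasiMeasurePreserving.ae
      (p := fun z => z ∉ bad) (measure_eq_zero_iff_ae_notMem.1 hbad0)
    exact this
  -- Fubini: each translate of `bad` is null, so almost every line in direction `u` meets `bad` in a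
  -- null set of times.
  have h2 : ∀ᵐ v ∂μ, ∀ᵐ t : ℝ, v + t • u ∉ bad := by
    rw [Measure.ae_ae_comm]
    · exact h1
    · have hc : Continuous fun x : E × ℝ => x.1 + x.2 • u := by fun_prop
      exact (hc.measurable hbadm).compl
  have key : ∀ v, v ∈ B → v + u ∈ B → (∀ᵐ t : ℝ, v + t • u ∉ bad) → W (v + u) - W v ≤ N u := by
    intro v hv hvu hgv
    have hseg : ∀ t ∈ Icc (0 : ℝ) 1, v + t • u ∈ B := by
      intro t ht
      have := (convex_ball c δ) hv hvu (sub_nonneg.2 ht.2) ht.1 (by ring)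
      convert this using 1
      module
    have hlip : LipschitzOnWith (K * ‖u‖₊) (fun t : ℝ => W (v + t • u)) (uIcc 0 1) := by
      rw [uIcc_of_le zero_le_one]
      refine hW.comp (g := W) (f := fun t : ℝ => v + t • u) (t := B) ?_ hseg
      refine LipschitzWith.lipschitzOnWith (LipschitzWith.of_dist_le_mul fun s t => ?_)
      simp [dist_eq_norm, ← sub_smul, norm_smul, mul_comm]
    have hac := hlip.absolutelyContinuousOnInterval
    have hftc := hac.integral_deriv_eq_sub
    simp only [one_smul, zero_smul, add_zero] at hftc
    rw [← hftc]
    have : N u = ∫ t in (0 : ℝ)..1, N u := by simp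
    rw [this]
    refine intervalIntegral.integral_mono_ae_restrict zero_le_one
      hac.intervalIntegrable_deriv intervalIntegrable_const ?_
    filter_upwards [ae_restrict_mem measurableSet_Icc, ae_restrict_of_ae hgv] with t ht hgt
    obtain ⟨hd, hb⟩ := hgood _ hgt (hseg t ht)
    have hline : HasDerivAt (fun t : ℝ => v + t • u) u t := by
      simpa using ((hasDerivAt_id t).smul_const u).const_add v
    have := hd.hasFDerivAt.comp_hasDerivAt t hline
    rw [show deriv (fun t : ℝ => W (v + t • u)) t = fderiv ℝ W (v + t • u) u from this.deriv]
    exact hb u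
  -- The segment from `p` itself may be bad, but good starting points are dense and `W` is
  -- continuous.
  have hfreq : ∃ᶠ v in 𝓝 p, W (v + u) - W v ≤ N u := by
    have hd : Dense {v | ∀ᵐ t : ℝ, v + t • u ∉ bad} := Measure.dense_of_ae h2
    have hf : ∃ᶠ v in 𝓝 p, v ∈ {v | ∀ᵐ t : ℝ, v + t • u ∉ bad} :=
      mem_closure_iff_frequently.1 (hd p)
    have hcq : ContinuousAt (fun v => v + u) p := by fun_prop
    have e1 : ∀ᶠ v in 𝓝 p, v + u ∈ B :=
      hcq.eventually_mem (hBo.mem_nhds (by simpa [hu] using hq))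
    have e0 : ∀ᶠ v in 𝓝 p, v ∈ B := hBo.mem_nhds hp
    refine (hf.and_eventually (e0.and e1)).mono ?_
    rintro v ⟨h, h', h''⟩
    exact key v h' h'' h
  have hWc : ∀ z ∈ B, ContinuousAt W z := fun z hz =>
    hW.continuousOn.continuousAt (hBo.mem_nhds hz)
  have hpu : p + u = q := by simp [hu]
  have hcont : Tendsto (fun v => W (v + u) - W v) (𝓝 p) (𝓝 (W q - W p)) := by
    have h3 : ContinuousAt (fun v => W (v + u)) p :=
      ContinuousAt.comp (g := W) (f := fun v => v + u) (by rw [hpu]; exact hWc q hq) (by fun_prop)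
    have := h3.tendsto.sub (hWc p hp).tendsto
    rwa [hpu] at this
  exact le_of_tendsto_of_frequently hcont hfreq

/-! ### The norm of a tangent space and its dual norm -/

variable {n : ℕ} {M : Type*} [TopologicalSpace M] [ChartedSpace (EuclideanSpace ℝ (Fin n)) M]

/-- The length of a tangent vector. -/
def speed [IsManifold (𝓡 n) ∞ M] (h : SmoothMetric n M) (x : M) (v : TangentSpace (𝓡 n) x) : ℝ :=
  Real.sqrt (h.inner x v v)

/-- The length of the tangent vector at `x₀` with coordinates `v` in the chart at `x₀`. -/
def chartSpeed [IsManifold (𝓡 n) ∞ M] (h : SmoothMetric n M) (x₀ : M)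
    (v : EuclideanSpace ℝ (Fin n)) : ℝ :=
  speed h x₀ v

section Pointwise

variable [IsManifold (𝓡 n) ∞ M] (h : SmoothMetric n M) (x : M)

theorem inner_self_nonneg (v : TangentSpace (𝓡 n) x) : 0 ≤ h.inner x v v := by
  by_cases hv : v = 0
  · simp [hv]
  · exact (h.pos x v hv).le

theorem speed_nonneg (v : TangentSpace (𝓡 n) x) : 0 ≤ speed h x v := Real.sqrt_nonneg _

theorem speed_smul (t : ℝ) (v : TangentSpace (𝓡 n) x) :
    speed h x (t • v) = |t| * speed h x v := by
  unfold speed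
  rw [← Real.sqrt_sq_eq_abs, ← Real.sqrt_mul (sq_nonneg t)]
  congr 1
  simp only [map_smul, smul_apply, smul_eq_mul]
  ring

theorem inner_le_speed_mul_speed (u v : TangentSpace (𝓡 n) x) :
    h.inner x u v ≤ speed h x u * speed h x v := by
  let B : LinearMap.BilinForm ℝ (TangentSpace (𝓡 n) x) :=
    LinearMap.mk₂ ℝ (fun u v => h.inner x u v) (by intros; simp) (by intros; simp)
      (by intros; simp) (by intros; simp)
  have hB : h.inner x u v * h.inner x v u ≤ h.inner x u u * h.inner x v v :=
    B.apply_mul_apply_le_of_forall_zero_le (fun y => inner_self_nonneg h x y) u v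
  rw [h.symm x v u] at hB
  unfold speed
  rw [← Real.sqrt_mul (inner_self_nonneg h x u)]
  exact Real.le_sqrt_of_sq_le (by rw [sq]; exact hB)

omit [IsManifold (𝓡 n) ∞ M] in
theorem sum_smul_coordVector (v : TangentSpace (𝓡 n) x) :
    ∑ i, (show EuclideanSpace ℝ (Fin n) from v).ofLp i • coordVector x i = v := by
  have := (EuclideanSpace.basisFun (Fin n) ℝ).sum_repr (show EuclideanSpace ℝ (Fin n) from v)
  simp only [EuclideanSpace.basisFun_apply] at this
  exact this

/-- A kernel vector of the Gram matrix gives a tangent vector orthogonal to the whole frame, hence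
to itself. -/
theorem isUnit_det_metricMatrix : IsUnit (metricMatrix h x).det := by
  rw [isUnit_iff_ne_zero]
  intro hdet
  obtain ⟨c, hc, hc0⟩ := Matrix.exists_mulVec_eq_zero_iff.2 hdet
  set v : TangentSpace (𝓡 n) x := ∑ i, c i • coordVector x i with hv
  have hvv : h.inner x v v = 0 := by
    have h1 : ∀ i, h.inner x (coordVector x i) v = 0 := by
      intro i
      have := congrFun hc0 i
      simp only [Matrix.mulVec, dotProduct, metricMatrix, Matrix.of_apply, Pi.zero_apply] at this
      rw [← this, hv, map_sum]
      exact Finset.sum_congr rfl fun j _ => by rw [map_smul, smul_eq_mul, mul_comm]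
    conv_lhs => rw [h.symm, hv, map_sum]
    refine Finset.sum_eq_zero fun i _ => ?_
    rw [map_smul, ← hv, h.symm, h1, smul_zero]
  have hv0 : v = 0 := by
    by_contra hne
    exact (h.pos x v hne).ne' hvv
  apply hc
  funext i
  have h2 : ∑ j, c j • (EuclideanSpace.single j 1 : EuclideanSpace ℝ (Fin n)) = 0 := hv0
  simpa [Pi.single_apply] using congrArg (fun z : EuclideanSpace ℝ (Fin n) => z i) h2

/-- Riesz representation of a covector, together with its conorm. -/
theorem exists_inner_eq (ξ : TangentSpace (𝓡 n) x →L[ℝ] ℝ) :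
    ∃ u : TangentSpace (𝓡 n) x, (∀ v, ξ v = h.inner x u v) ∧ coNorm h x ξ = speed h x u := by
  set S := metricMatrix h x with hS
  set c : Fin n → ℝ := fun i => ξ (coordVector x i) with hc
  set d := S⁻¹.mulVec c with hd
  have hSd : S.mulVec d = c := by
    rw [hd, Matrix.mulVec_mulVec, Matrix.mul_nonsing_inv _ (isUnit_det_metricMatrix h x),
      Matrix.one_mulVec]
  set u : TangentSpace (𝓡 n) x := ∑ i, d i • coordVector x i with hu
  have h1 : ∀ i, h.inner x u (coordVector x i) = ξ (coordVector x i) := by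
    intro i
    have := congrFun hSd i
    simp only [Matrix.mulVec, dotProduct, hS, metricMatrix, Matrix.of_apply, hc] at this
    rw [← this, h.symm, hu, map_sum]
    exact Finset.sum_congr rfl fun j _ => by rw [map_smul, smul_eq_mul, mul_comm]
  have h2 : ∀ v, ξ v = h.inner x u v := by
    intro v
    rw [← sum_smul_coordVector x v, map_sum, map_sum]
    exact Finset.sum_congr rfl fun i _ => by rw [map_smul, map_smul, h1]
  refine ⟨u, h2, ?_⟩
  unfold coNorm speed
  congr 1
  rw [← h2, hu, map_sum]
  refine Finset.sum_congr rfl fun i _ => ?_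
  rw [map_smul, smul_eq_mul, hd, Matrix.mulVec, dotProduct, Finset.sum_mul]
  exact Finset.sum_congr rfl fun j _ => by simp only [hc]; ring

/-- With `coNorm_le_one`, this replaces the inverse matrix by duality: Cauchy–Schwarz against the
Riesz vector here, evaluation at the Riesz vector there. -/
theorem apply_le_speed {ξ : TangentSpace (𝓡 n) x →L[ℝ] ℝ} (hξ : coNorm h x ξ ≤ 1)
    (v : TangentSpace (𝓡 n) x) : ξ v ≤ speed h x v := by
  obtain ⟨u, hu, hn⟩ := exists_inner_eq h x ξ
  rw [hu v]
  refine (inner_le_speed_mul_speed h x u v).trans ?_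
  rw [hn] at hξ
  exact mul_le_of_le_one_left (speed_nonneg h x v) hξ

theorem coNorm_le_one {ξ : TangentSpace (𝓡 n) x →L[ℝ] ℝ} (hξ : ∀ v, ξ v ≤ speed h x v) :
    coNorm h x ξ ≤ 1 := by
  obtain ⟨u, hu, hn⟩ := exists_inner_eq h x ξ
  rw [hn]
  have h1 := hξ u
  rw [hu u] at h1
  have h2 : speed h x u * speed h x u = h.inner x u u :=
    Real.mul_self_sqrt (inner_self_nonneg h x u)
  by_contra hcon
  nlinarith

theorem chartSpeed_nonneg (v : EuclideanSpace ℝ (Fin n)) : 0 ≤ chartSpeed h x v :=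
  speed_nonneg h x v

theorem chartSpeed_smul (t : ℝ) (v : EuclideanSpace ℝ (Fin n)) :
    chartSpeed h x (t • v) = |t| * chartSpeed h x v :=
  speed_smul h x t v

theorem continuous_chartSpeed : Continuous (chartSpeed h x) := by
  let B : EuclideanSpace ℝ (Fin n) →L[ℝ] EuclideanSpace ℝ (Fin n) →L[ℝ] ℝ := h.inner x
  have : Continuous fun v => Real.sqrt (B v v) := by fun_prop
  exact this

theorem exists_chartSpeed_le_norm :
    ∃ C : NNReal, ∀ v : EuclideanSpace ℝ (Fin n), chartSpeed h x v ≤ C * ‖v‖ := by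
  let B : EuclideanSpace ℝ (Fin n) →L[ℝ] EuclideanSpace ℝ (Fin n) →L[ℝ] ℝ := h.inner x
  refine ⟨NNReal.sqrt ‖B‖₊, fun v => ?_⟩
  have h1 : B v v ≤ ‖B‖ * ‖v‖ * ‖v‖ := (Real.le_norm_self _).trans (B.le_opNorm₂ v v)
  refine Real.sqrt_le_iff.2 ⟨by positivity, h1.trans_eq ?_⟩
  rw [mul_pow, Real.coe_sqrt, Real.sq_sqrt (by simp)]
  simp only [coe_nnnorm]
  ring

end Pointwise

/-! ### Comparison with the metric frozen at a point -/

open Bundle in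
theorem eventually_norm_le_norm_symmL_trivializationAt {B F : Type*} {E : B → Type*}
    [TopologicalSpace B] [NormedAddCommGroup F] [NormedSpace ℝ F]
    [TopologicalSpace (TotalSpace F E)] [∀ x, NormedAddCommGroup (E x)]
    [∀ x, InnerProductSpace ℝ (E x)] [FiberBundle F E] [VectorBundle ℝ F E]
    [IsContinuousRiemannianBundle F E] (x₀ : B) {r : ℝ} (hr : 1 < r) :
    ∀ᶠ y in 𝓝 x₀, ∀ u : E y, ‖u‖ ≤ r * ‖(trivializationAt F E x₀).symmL ℝ x₀
      ((trivializationAt F E x₀).continuousLinearMapAt ℝ y u)‖ := by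
  filter_upwards [eventually_norm_symmL_trivializationAt_comp_self_lt F E x₀ hr,
    (trivializationAt F E x₀).open_baseSet.mem_nhds
      (FiberBundle.mem_baseSet_trivializationAt' x₀)] with y hy hys u
  -- The operator of norm below `r` passes from the fibre at `x₀` to that at `y`; on this argument
  -- the trivializations cancel and leave `u`.
  refine le_trans (le_of_eq ?_) (ContinuousLinearMap.le_of_opNorm_le _ hy.le _)
  rw [ContinuousLinearMap.comp_apply, Trivialization.continuousLinearMapAt_symmL,
    Trivialization.symmL_continuousLinearMapAt _ hys]
  exact FiberBundle.mem_baseSet_trivializationAt' x₀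

section RiemannianBundle

open scoped Bundle

variable [Bundle.RiemannianBundle (fun x : M => TangentSpace (𝓡 n) x)] [IsManifold (𝓡 n) 1 M]
  [IsContinuousRiemannianBundle (EuclideanSpace ℝ (Fin n)) (fun x : M => TangentSpace (𝓡 n) x)]

/-- The trivialization at `x₀` is the differential of the chart over `y`, and the identity over `x₀`
itself. -/
theorem eventually_norm_le_norm_mfderiv_extChartAt (x₀ : M) {r : ℝ} (hr : 1 < r) :
    ∀ᶠ y in 𝓝 x₀, ∀ u : TangentSpace (𝓡 n) y,
      ‖u‖ ≤ r * ‖(show TangentSpace (𝓡 n) x₀ from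
        mfderiv (𝓡 n) 𝓘(ℝ, EuclideanSpace ℝ (Fin n)) (extChartAt (𝓡 n) x₀) y u)‖ := by
  filter_upwards [eventually_norm_le_norm_symmL_trivializationAt
    (F := EuclideanSpace ℝ (Fin n)) (E := fun x : M => TangentSpace (𝓡 n) x) x₀ hr,
    chart_source_mem_nhds (EuclideanSpace ℝ (Fin n)) x₀] with y hy hys u
  have := hy u
  rw [TangentBundle.continuousLinearMapAt_trivializationAt hys] at this
  rw [TangentBundle.symmL_trivializationAt_eq_core (mem_chart_source _ x₀)] at this
  have h2 := (tangentBundleCore (𝓡 n) M).coordChange_self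
    (achart (EuclideanSpace ℝ (Fin n)) x₀) x₀ (mem_chart_source _ x₀)
    (mfderiv (𝓡 n) 𝓘(ℝ, EuclideanSpace ℝ (Fin n)) (extChartAt (𝓡 n) x₀) y u)
  exact this.trans_eq (congrArg (fun z : TangentSpace (𝓡 n) x₀ => r * ‖z‖) h2)

end RiemannianBundle

open scoped Bundle in
/-- Near `x₀` the metric is almost the metric at `x₀`, read in the chart at `x₀`. -/
theorem eventually_speed_le [IsManifold (𝓡 n) ∞ M] (h : SmoothMetric n M) (x₀ : M) {r : ℝ}
    (hr : 1 < r) :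
    ∀ᶠ y in 𝓝 x₀, ∀ u : TangentSpace (𝓡 n) y,
      speed h y u ≤ r * chartSpeed h x₀ (mfderiv (𝓡 n) 𝓘(ℝ, EuclideanSpace ℝ (Fin n))
        (extChartAt (𝓡 n) x₀) y u) := by
  let _ : Bundle.RiemannianBundle (fun x : M => TangentSpace (𝓡 n) x) := ⟨h.toRiemannianMetric⟩
  have _ : IsContinuousRiemannianBundle (EuclideanSpace ℝ (Fin n))
      (fun x : M => TangentSpace (𝓡 n) x) :=
    ⟨⟨h.inner, h.contMDiff.continuous, fun _ _ _ => rfl⟩⟩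
  have hsp : ∀ (y : M) (u : TangentSpace (𝓡 n) y), speed h y u = ‖u‖ := fun y u => by
    rw [norm_eq_sqrt_real_inner]; rfl
  have : IsManifold (𝓡 n) 1 M := IsManifold.of_le (n := ∞) (by simp)
  filter_upwards [eventually_norm_le_norm_mfderiv_extChartAt (n := n) (M := M) x₀ hr] with y hy u
  exact (hsp y u).trans_le ((hy u).trans_eq (congrArg (fun z => r * z) (hsp x₀ _).symm))

/-! ### Locally short functions -/

section

variable [IsManifold (𝓡 n) ∞ M] (h : SmoothMetric n M)

/-- Near every point, the increments of `w` are almost bounded by the length at that point of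
the increments of the coordinates. -/
def IsLocallyShort (w : M → ℝ) : Prop :=
  ∀ x₀ : M, ∀ r : ℝ, 1 < r → ∃ s ∈ 𝓝 (extChartAt (𝓡 n) x₀ x₀), ∀ p ∈ s, ∀ q ∈ s,
    w ((extChartAt (𝓡 n) x₀).symm q) - w ((extChartAt (𝓡 n) x₀).symm p) ≤
      r * chartSpeed h x₀ (q - p)

/-- Around `x₀` there is a chart ball in which the metric is almost the metric at `x₀`. -/
theorem exists_ball_speed_le (x₀ : M) {r : ℝ} (hr : 1 < r) :
    ∃ δ > 0, ∀ z ∈ Metric.ball (extChartAt (𝓡 n) x₀ x₀) δ, z ∈ (extChartAt (𝓡 n) x₀).target ∧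
      ∀ u : TangentSpace (𝓡 n) ((extChartAt (𝓡 n) x₀).symm z),
        speed h ((extChartAt (𝓡 n) x₀).symm z) u ≤ r * chartSpeed h x₀
          (mfderiv (𝓡 n) 𝓘(ℝ, EuclideanSpace ℝ (Fin n)) (extChartAt (𝓡 n) x₀)
            ((extChartAt (𝓡 n) x₀).symm z) u) := by
  have h1 := eventually_speed_le h x₀ hr
  have h2 : Tendsto (extChartAt (𝓡 n) x₀).symm (𝓝 (extChartAt (𝓡 n) x₀ x₀)) (𝓝 x₀) := by
    have := continuousAt_extChartAt_symm (I := 𝓡 n) x₀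
    rwa [ContinuousAt, extChartAt_to_inv] at this
  have h3 : (extChartAt (𝓡 n) x₀).target ∈ 𝓝 (extChartAt (𝓡 n) x₀ x₀) :=
    extChartAt_target_mem_nhds x₀
  obtain ⟨δ, hδ, hb⟩ := Metric.eventually_nhds_iff_ball.1 ((h2.eventually h1).and h3)
  exact ⟨δ, hδ, fun z hz => ⟨(hb z hz).2, (hb z hz).1⟩⟩

theorem IsAdmissible.isLocallyShort {w : M → ℝ} (hw : IsAdmissible h w) : IsLocallyShort h w := by
  have : IsManifold (𝓡 n) 1 M := IsManifold.of_le (n := ∞) (by simp)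
  intro x₀ r hr
  set φ := extChartAt (𝓡 n) x₀ with hφ
  have htgt : (chartAt (EuclideanSpace ℝ (Fin n)) x₀).target = φ.target := by simp [hφ, mfld_simps]
  have htm : φ x₀ ∈ φ.target := mem_extChartAt_target x₀
  obtain ⟨δ, hδ, hm⟩ := exists_ball_speed_le h x₀ hr
  have hL := hw.1 _ (chart_mem_atlas _ x₀)
  rw [htgt] at hL
  obtain ⟨K, t, ht, hK⟩ := hL htm
  rw [nhdsWithin_eq_nhds.2 (extChartAt_target_mem_nhds x₀)] at ht
  obtain ⟨δ', hδ', ht'⟩ := Metric.mem_nhds_iff.1 ht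
  set ρ := min δ δ'
  have hρ : 0 < ρ := lt_min hδ hδ'
  refine ⟨Metric.ball (φ x₀) ρ, Metric.ball_mem_nhds _ hρ, fun p hp q hq => ?_⟩
  refine sub_le_of_ae_fderiv_le (W := w ∘ φ.symm) (N := fun v => r * chartSpeed h x₀ v) volume
    (hK.mono ((Metric.ball_subset_ball (min_le_right _ _)).trans ht')) ?_ hp hq
  have hae := hw.2 _ (chart_mem_atlas _ x₀)
  rw [ae_restrict_iff' (chartAt (EuclideanSpace ℝ (Fin n)) x₀).open_target.measurableSet] at hae
  filter_upwards [hae] with z hz hzB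
  obtain ⟨hzt, hzm⟩ := hm z (Metric.ball_subset_ball (min_le_left _ _) hzB)
  obtain ⟨hd, hc⟩ : MDifferentiableAt (𝓡 n) 𝓘(ℝ, ℝ) w (φ.symm z) ∧
    coNorm h (φ.symm z) (differential w (φ.symm z)) ≤ 1 := hz (by rwa [htgt])
  have hsymm : MDifferentiableAt 𝓘(ℝ, EuclideanSpace ℝ (Fin n)) (𝓡 n) φ.symm z := by
    have := mdifferentiableWithinAt_extChartAt_symm (I := 𝓡 n) hzt
    rwa [modelWithCornersSelf_coe, range_id, mdifferentiableWithinAt_univ] at this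
  have hcomp := mfderiv_comp z hd hsymm
  refine ⟨(hd.comp z hsymm).differentiableAt, fun v => ?_⟩
  have hinv := mfderiv_extChartAt_comp_mfderivWithin_extChartAt_symm (I := 𝓡 n) hzt
  have h1 : fderiv ℝ (w ∘ φ.symm) z v = differential w (φ.symm z)
      (mfderiv 𝓘(ℝ, EuclideanSpace ℝ (Fin n)) (𝓡 n) φ.symm z v) := by
    rw [← mfderiv_eq_fderiv, hcomp]
    rfl
  rw [h1]
  -- The differential of the chart undoes that of its inverse, leaving the coordinate vector `v`.
  refine (apply_le_speed h _ hc _).trans ((hzm _).trans (le_of_eq ?_))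
  congr 2
  have h2 := congrArg (fun L => L v) hinv
  simp only [modelWithCornersSelf_coe, range_id, mfderivWithin_univ] at h2
  exact h2

/-- The one-sided directional derivatives of a locally short function. -/
theorem IsLocallyShort.deriv_le {w : M → ℝ} (hw : IsLocallyShort h w) {x₀ : M}
    {c : ℝ → EuclideanSpace ℝ (Fin n)} {u : EuclideanSpace ℝ (Fin n)} {t f' : ℝ}
    (hct : c t = extChartAt (𝓡 n) x₀ x₀) (hc : HasDerivAt c u t)
    (hf : HasDerivAt (fun s => w ((extChartAt (𝓡 n) x₀).symm (c s))) f' t) :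
    f' ≤ chartSpeed h x₀ u := by
  have key : ∀ r : ℝ, 1 < r → f' ≤ r * chartSpeed h x₀ u := by
    intro r hr
    obtain ⟨s, hs, hsw⟩ := hw x₀ r hr
    have h1 := hf.tendsto_slope.mono_left (nhdsGT_le_nhdsNE t)
    have h2 := hc.tendsto_slope.mono_left (nhdsGT_le_nhdsNE t)
    have h3 := (((continuous_chartSpeed h x₀).tendsto u).comp h2).const_mul r
    refine le_of_tendsto_of_tendsto h1 h3 ?_
    have h4 : ∀ᶠ τ in 𝓝[>] t, c τ ∈ s := by
      have : Tendsto c (𝓝[>] t) (𝓝 (c t)) := hc.continuousAt.continuousWithinAt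
      rw [hct] at this
      exact this.eventually hs
    filter_upwards [h4, self_mem_nhdsWithin] with τ hτ hτt
    have hpos : 0 < τ - t := sub_pos.2 hτt
    have h5 := hsw (c t) (by rw [hct]; exact mem_of_mem_nhds hs) (c τ) hτ
    simp only [slope, vsub_eq_sub, smul_eq_mul, Function.comp_apply]
    rw [chartSpeed_smul, abs_of_pos (inv_pos.2 hpos), mul_left_comm]
    exact mul_le_mul_of_nonneg_left h5 (inv_pos.2 hpos).le
  have hlim : Tendsto (fun r : ℝ => r * chartSpeed h x₀ u) (𝓝[>] 1) (𝓝 (1 * chartSpeed h x₀ u)) :=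
    (Continuous.tendsto (by fun_prop) 1).mono_left nhdsWithin_le_nhds
  rw [one_mul] at hlim
  refine ge_of_tendsto hlim ?_
  filter_upwards [self_mem_nhdsWithin] with r hr
  exact key r hr

theorem IsLocallyShort.exists_lipschitzOnWith {w : M → ℝ} (hw : IsLocallyShort h w) (x₀ : M) :
    ∃ K : NNReal, ∃ s ∈ 𝓝 (extChartAt (𝓡 n) x₀ x₀),
      LipschitzOnWith K (w ∘ (extChartAt (𝓡 n) x₀).symm) s := by
  obtain ⟨s, hs, hsw⟩ := hw x₀ 2 one_lt_two
  obtain ⟨C, hC⟩ := exists_chartSpeed_le_norm h x₀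
  refine ⟨2 * C, s, hs, LipschitzOnWith.of_dist_le_mul fun p hp q hq => ?_⟩
  have h1 := hsw p hp q hq
  have h2 := hsw q hq p hp
  have h3 := hC (q - p)
  have h4 := hC (p - q)
  rw [norm_sub_rev] at h3
  rw [Real.dist_eq, dist_eq_norm, abs_le]
  simp only [Function.comp_apply, NNReal.coe_mul, NNReal.coe_ofNat]
  constructor <;> nlinarith

end

/-! ### Growth along curves -/

theorem ofReal_integral_le_lintegral_ofReal {α : Type*} [MeasurableSpace α] {μ : Measure α}
    {f : α → ℝ} (hf : Integrable f μ) :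
    ENNReal.ofReal (∫ x, f x ∂μ) ≤ ∫⁻ x, ENNReal.ofReal (f x) ∂μ := by
  rw [integral_eq_lintegral_pos_part_sub_lintegral_neg_part hf]
  exact (ENNReal.ofReal_le_ofReal (sub_le_self _ ENNReal.toReal_nonneg)).trans
    ENNReal.ofReal_toReal_le

section

variable [IsManifold (𝓡 n) ∞ M] (h : SmoothMetric n M)

theorem curveLength_add (γ : ℝ → M) {a b c : ℝ} (hab : a ≤ b) (hbc : b ≤ c) :
    curveLength h γ a c = curveLength h γ a b + curveLength h γ b c := by
  unfold curveLength
  rw [← Icc_union_Ioc_eq_Icc hab hbc, lintegral_union measurableSet_Ioc,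
    setLIntegral_congr (Ioc_ae_eq_Icc (a := b) (b := c))]
  exact disjoint_left.2 fun t ht ht' => absurd ht.2 (not_le.2 ht'.1)

omit [IsManifold (𝓡 n) ∞ M] in
/-- A curve read in the chart at one of its points. -/
theorem hasDerivAt_extChartAt_comp {γ : ℝ → M} {t : ℝ}
    (hγ : MDifferentiableAt 𝓘(ℝ, ℝ) (𝓡 n) γ t) :
    HasDerivAt (fun s => extChartAt (𝓡 n) (γ t) (γ s))
      (show EuclideanSpace ℝ (Fin n) from velocity n γ t) t := by
  have h1 : HasFDerivWithinAt (fun s => extChartAt (𝓡 n) (γ t) (γ s))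
      (show ℝ →L[ℝ] EuclideanSpace ℝ (Fin n) from mfderiv 𝓘(ℝ, ℝ) (𝓡 n) γ t) univ t := by
    rw [← range_id]
    exact hγ.hasMFDerivAt.2
  exact (hasFDerivWithinAt_univ.1 h1).hasDerivAt

/-- Compactness of the interval upgrades this to a Lipschitz bound, hence to absolute continuity and
the fundamental theorem of calculus. -/
theorem IsLocallyShort.locallyLipschitzOn_comp {w : M → ℝ} (hw : IsLocallyShort h w)
    {γ : ℝ → M} {c d : ℝ} (hγ : ContMDiffOn 𝓘(ℝ, ℝ) (𝓡 n) ∞ γ (Icc c d)) :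
    LocallyLipschitzOn (Icc c d) (w ∘ γ) := by
  intro t ht
  obtain ⟨K, s, hs, hK⟩ := hw.exists_lipschitzOnWith h (γ t)
  obtain ⟨hcont, hdiff⟩ := contMDiffWithinAt_iff.1 (hγ t ht)
  simp only [modelWithCornersSelf_coe, range_id, inter_univ,
    extChartAt_model_space_eq_id, PartialEquiv.refl_coe, PartialEquiv.refl_symm, id,
    preimage_id] at hdiff
  obtain ⟨K', u, hu, hK'⟩ := (hdiff.of_le (m := 1) (by simp)).exists_lipschitzOnWith
    (convex_Icc c d)
  have h1 : ∀ᶠ τ in 𝓝[Icc c d] t, γ τ ∈ (extChartAt (𝓡 n) (γ t)).source :=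
    hcont.eventually (extChartAt_source_mem_nhds (γ t))
  have h2 : ∀ᶠ τ in 𝓝[Icc c d] t, extChartAt (𝓡 n) (γ t) (γ τ) ∈ s :=
    ((continuousAt_extChartAt (γ t)).comp_continuousWithinAt hcont).eventually hs
  refine ⟨K * K', u ∩ {τ | γ τ ∈ (extChartAt (𝓡 n) (γ t)).source ∧
    extChartAt (𝓡 n) (γ t) (γ τ) ∈ s}, inter_mem hu (h1.and h2), ?_⟩
  intro σ hσ τ hτ
  have h3 := hK.comp (hK'.mono inter_subset_left) (fun τ hτ => hτ.2.2) hσ hτ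
  simp only [Function.comp_apply, id] at h3 ⊢
  rwa [(extChartAt (𝓡 n) (γ t)).left_inv hσ.2.1, (extChartAt (𝓡 n) (γ t)).left_inv hτ.2.1] at h3

theorem IsLocallyShort.ofReal_sub_le_curveLength_of_contMDiffOn {w : M → ℝ}
    (hw : IsLocallyShort h w) {γ : ℝ → M} {c d : ℝ} (hcd : c ≤ d)
    (hγ : ContMDiffOn 𝓘(ℝ, ℝ) (𝓡 n) ∞ γ (Icc c d)) :
    ENNReal.ofReal (w (γ d) - w (γ c)) ≤ curveLength h γ c d := by
  obtain ⟨K, hK⟩ := (hw.locallyLipschitzOn_comp h hγ).exists_lipschitzOnWith_of_compact isCompact_Icc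
  rw [← uIcc_of_le hcd] at hK
  have hac := hK.absolutelyContinuousOnInterval
  have hftc := hac.integral_deriv_eq_sub
  have hint := hac.intervalIntegrable_deriv
  rw [intervalIntegrable_iff_integrableOn_Ioo_of_le hcd] at hint
  rw [intervalIntegral.integral_of_le hcd, integral_Ioc_eq_integral_Ioo] at hftc
  change _ = w (γ d) - w (γ c) at hftc
  -- On the open interval the curve has a two-sided derivative; smoothness on the closed piece says
  -- nothing about `velocity` at its ends.
  rw [← hftc, curveLength, ← setLIntegral_congr Ioo_ae_eq_Icc]
  refine (ofReal_integral_le_lintegral_ofReal hint).trans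
    (setLIntegral_mono' measurableSet_Ioo fun t ht => ENNReal.ofReal_le_ofReal ?_)
  by_cases hf : DifferentiableAt ℝ (w ∘ γ) t
  · have hγt : ContMDiffAt 𝓘(ℝ, ℝ) (𝓡 n) ∞ γ t := hγ.contMDiffAt (Icc_mem_nhds ht.1 ht.2)
    have hu := hasDerivAt_extChartAt_comp (hγt.mdifferentiableAt (by simp))
    refine hw.deriv_le h rfl hu (hf.hasDerivAt.congr_of_eventuallyEq ?_)
    filter_upwards [hγt.continuousAt.eventually (extChartAt_source_mem_nhds (I := 𝓡 n) (γ t))]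
      with τ hτ
    simp only [Function.comp_apply]
    rw [(extChartAt (𝓡 n) (γ t)).left_inv hτ]
  -- Here `deriv` takes its default value 0, so no almost everywhere argument is needed.
  · rw [deriv_zero_of_not_differentiableAt hf]
    exact Real.sqrt_nonneg _

theorem IsLocallyShort.ofReal_sub_le_curveLength {w : M → ℝ} (hw : IsLocallyShort h w)
    {γ : ℝ → M} {a b : ℝ} (hγ : IsPiecewiseSmooth n γ a b) :
    ENNReal.ofReal (w (γ b) - w (γ a)) ≤ curveLength h γ a b := by
  obtain ⟨N, t, ht, rfl, rfl, hs⟩ := hγ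
  induction N with
  | zero => simp
  | succ k ih =>
    rw [curveLength_add h γ (ht (Nat.zero_le k)) (ht k.le_succ)]
    refine le_trans ?_ (add_le_add (ih fun i hi => hs i (hi.trans k.lt_succ_self))
      (hw.ofReal_sub_le_curveLength_of_contMDiffOn h (ht k.le_succ) (hs k k.lt_succ_self)))
    refine le_trans (ENNReal.ofReal_le_ofReal (le_of_eq ?_)) ENNReal.ofReal_add_le
    ring

theorem lipDist_le_riemDist (x y : M) : lipDist h x y ≤ riemDist h x y := by
  refine iSup₂_le fun w hw => le_iInf fun γ => le_iInf fun a => le_iInf fun b => le_iInf fun hγ =>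
    le_iInf fun hx => le_iInf fun hy => ?_
  have h1 := (hw.isLocallyShort h).ofReal_sub_le_curveLength h hγ
  rw [hx, hy] at h1
  refine le_trans ?_ (EReal.coe_ennreal_le_coe_ennreal_iff.2 h1)
  rw [EReal.coe_ennreal_ofReal]
  exact EReal.coe_le_coe_iff.2 (le_max_left _ _)

/-! ### Locally short functions are admissible -/

theorem IsLocallyShort.isLocLipschitz {w : M → ℝ} (hw : IsLocallyShort h w) :
    IsLocLipschitz n w := by
  have : IsManifold (𝓡 n) 1 M := IsManifold.of_le (n := ∞) (by simp)
  intro e he z hz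
  obtain ⟨K, s, hs, hK⟩ := hw.exists_lipschitzOnWith h (e.symm z)
  set φ := extChartAt (𝓡 n) (e.symm z) with hφ
  have he' : e ∈ IsManifold.maximalAtlas (𝓡 n) 1 M := IsManifold.subset_maximalAtlas he
  have hsymm : ContMDiffAt (𝓡 n) (𝓡 n) 1 e.symm z :=
    (contMDiffOn_symm_of_mem_maximalAtlas he').contMDiffAt (e.open_target.mem_nhds hz)
  -- Shortness is stated in preferred charts only; the transition from an arbitrary chart is C¹,
  -- hence locally Lipschitz.
  have hcd : ContDiffAt ℝ 1 (φ ∘ e.symm) z := by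
    have : ContMDiffAt (𝓡 n) 𝓘(ℝ, EuclideanSpace ℝ (Fin n)) 1 (φ ∘ e.symm) z :=
      (contMDiffAt_extChartAt (I := 𝓡 n) (x := e.symm z)).comp z hsymm
    exact this.contDiffAt
  obtain ⟨K', u, hu, hK'⟩ := hcd.exists_lipschitzOnWith
  have h1 : ∀ᶠ τ in 𝓝 z, e.symm τ ∈ φ.source :=
    hsymm.continuousAt.eventually (extChartAt_source_mem_nhds (e.symm z))
  have h2 : ∀ᶠ τ in 𝓝 z, φ (e.symm τ) ∈ s := hcd.continuousAt.eventually hs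
  refine ⟨K * K', u ∩ {τ | e.symm τ ∈ φ.source ∧ φ (e.symm τ) ∈ s},
    mem_nhdsWithin_of_mem_nhds (inter_mem hu (h1.and h2)), ?_⟩
  intro σ hσ τ hτ
  have h3 := hK.comp (hK'.mono inter_subset_left) (fun τ hτ => hτ.2.2) hσ hτ
  simp only [Function.comp_apply] at h3 ⊢
  rwa [φ.left_inv hσ.2.1, φ.left_inv hτ.2.1] at h3

/-- Rademacher's theorem, applied on small neighbourhoods in each chart; a locally null set is null.
-/
theorem IsLocLipschitz.almostEverywhere_mdifferentiableAt {w : M → ℝ} (hw : IsLocLipschitz n w) :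
    AlmostEverywhere n fun x : M => MDifferentiableAt (𝓡 n) 𝓘(ℝ, ℝ) w x := by
  have : IsManifold (𝓡 n) 1 M := IsManifold.of_le (n := ∞) (by simp)
  intro e he
  rw [ae_restrict_iff' e.open_target.measurableSet]
  have hdiff : ∀ᵐ z, z ∈ e.target → DifferentiableAt ℝ (w ∘ e.symm) z := by
    refine measure_null_of_locally_null _ fun z hz => ?_
    have hzt : z ∈ e.target := by
      by_contra hcon
      exact hz fun h' => absurd h' hcon
    obtain ⟨K, t, ht, hK⟩ := hw e he hzt
    rw [nhdsWithin_eq_nhds.2 (e.open_target.mem_nhds hzt)] at ht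
    obtain ⟨u, hut, huo, hzu⟩ := mem_nhds_iff.1 ht
    refine ⟨_, inter_mem_nhdsWithin _ (huo.mem_nhds hzu), ?_⟩
    refine measure_mono_null ?_ (hK.mono hut).ae_differentiableWithinAt_of_mem
    rintro p ⟨hp, hpu⟩ hcon
    exact hp fun _ => (hcon hpu).differentiableAt (huo.mem_nhds hpu)
  filter_upwards [hdiff] with z hz hzt
  have hze : e.symm z ∈ e.source := e.map_target hzt
  have h1 : MDifferentiableAt (𝓡 n) (𝓡 n) e (e.symm z) :=
    mdifferentiableAt_atlas he hze
  have h2 : MDifferentiableAt 𝓘(ℝ, EuclideanSpace ℝ (Fin n)) 𝓘(ℝ, ℝ) (w ∘ e.symm)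
      (e (e.symm z)) := by
    rw [e.right_inv hzt]
    exact (hz hzt).mdifferentiableAt
  refine (h2.comp (e.symm z) h1).congr_of_eventuallyEq ?_
  filter_upwards [e.open_source.mem_nhds hze] with y hy
  simp only [Function.comp_apply]
  rw [e.left_inv hy]

theorem IsLocallyShort.differential_le {w : M → ℝ} (hw : IsLocallyShort h w) {x : M}
    (hx : MDifferentiableAt (𝓡 n) 𝓘(ℝ, ℝ) w x) (v : TangentSpace (𝓡 n) x) :
    differential w x v ≤ speed h x v := by
  have hd : HasFDerivWithinAt (w ∘ (extChartAt (𝓡 n) x).symm)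
      (show EuclideanSpace ℝ (Fin n) →L[ℝ] ℝ from differential w x) univ
      (extChartAt (𝓡 n) x x) := by
    rw [← range_id]
    exact hx.hasMFDerivAt.2
  rw [hasFDerivWithinAt_univ] at hd
  set V : EuclideanSpace ℝ (Fin n) := v
  have hc : HasDerivAt (fun t : ℝ => extChartAt (𝓡 n) x x + t • V) V 0 := by
    simpa using ((hasDerivAt_id (0 : ℝ)).smul_const V).const_add (extChartAt (𝓡 n) x x)
  have h0 : extChartAt (𝓡 n) x x + (0 : ℝ) • V = extChartAt (𝓡 n) x x := by simp
  rw [← h0] at hd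
  exact hw.deriv_le h h0 hc (hd.comp_hasDerivAt (0 : ℝ) hc :)

theorem IsLocallyShort.isAdmissible {w : M → ℝ} (hw : IsLocallyShort h w) :
    IsAdmissible h w := by
  have hL := hw.isLocLipschitz h
  refine ⟨hL, fun e he => ?_⟩
  filter_upwards [hL.almostEverywhere_mdifferentiableAt e he] with z hz
  exact ⟨hz, coNorm_le_one h _ fun v => hw.differential_le h hz v⟩

end

/-! ### Appending chart segments to curves -/

section

theorem IsPiecewiseSmooth.ite_le {γ c : ℝ → M} {a b b' : ℝ} (hγ : IsPiecewiseSmooth n γ a b)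
    (hb : b ≤ b') (hc : ContMDiffOn 𝓘(ℝ, ℝ) (𝓡 n) ∞ c (Icc b b')) (hcb : c b = γ b) :
    IsPiecewiseSmooth n (fun t => if t ≤ b then γ t else c t) a b' := by
  obtain ⟨N, t, ht, rfl, rfl, hs⟩ := hγ
  refine ⟨N + 1, fun i => if i ≤ N then t i else b', ?_, by simp, by simp, fun i hi => ?_⟩
  · intro i j hij
    by_cases hj : j ≤ N
    · simpa [hj, hij.trans hj] using ht hij
    · by_cases hi : i ≤ N
      · simpa [hi, hj] using (ht hi).trans hb
      · simp [hi, hj]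
  · rcases (Nat.lt_succ_iff.1 hi).lt_or_eq with hlt | rfl
    · simp only [hlt.le, if_true, Nat.succ_le_of_lt hlt]
      refine (hs i hlt).congr fun τ hτ => ?_
      exact if_pos (hτ.2.trans (ht hlt))
    · simp only [le_refl, if_true, Nat.not_succ_le_self, if_false]
      -- At the junction itself the glued curve takes the value of `γ`, so `hcb` is needed there.
      refine hc.congr fun τ hτ => ?_
      by_cases h' : τ ≤ t i
      · rw [if_pos h', le_antisymm h' hτ.1, hcb]
      · rw [if_neg h']

variable [IsManifold (𝓡 n) ∞ M] (h : SmoothMetric n M)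

/-- Velocity depends only on the germ of the curve. At a junction the germs may differ, hence the
open interval; its end points are null. -/
theorem curveLength_congr {γ γ' : ℝ → M} {a b : ℝ} (hγ : EqOn γ γ' (Ioo a b)) :
    curveLength h γ a b = curveLength h γ' a b := by
  unfold curveLength
  rw [← setLIntegral_congr (Ioo_ae_eq_Icc (a := a) (b := b)),
    ← setLIntegral_congr (Ioo_ae_eq_Icc (a := a) (b := b))]
  refine setLIntegral_congr_fun measurableSet_Ioo fun t ht => congrArg ENNReal.ofReal ?_
  have h1 : γ =ᶠ[𝓝 t] γ' := eventuallyEq_of_mem (Ioo_mem_nhds ht.1 ht.2) hγ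
  have h2 : (show EuclideanSpace ℝ (Fin n) from velocity n γ t) = velocity n γ' t := by
    have := h1.mfderiv_eq (I := 𝓘(ℝ, ℝ)) (I' := 𝓡 n)
    exact congrArg (fun L : ℝ →L[ℝ] EuclideanSpace ℝ (Fin n) => L 1) this
  change chartSpeed h (γ t) (velocity n γ t) = chartSpeed h (γ' t) (velocity n γ' t)
  exact congrArg₂ (chartSpeed h) (hγ ht) h2

theorem riemDist_le {γ : ℝ → M} {a b : ℝ} (hγ : IsPiecewiseSmooth n γ a b) :
    riemDist h (γ a) (γ b) ≤ ((curveLength h γ a b : ℝ≥0∞) : EReal) :=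
  iInf_le_of_le γ <| iInf_le_of_le a <| iInf_le_of_le b <| iInf_le_of_le hγ <|
    iInf_le_of_le rfl <| iInf_le _ rfl

theorem riemDist_nonneg (x y : M) : 0 ≤ riemDist h x y :=
  le_iInf fun _ => le_iInf fun _ => le_iInf fun _ => le_iInf fun _ => le_iInf fun _ =>
    le_iInf fun _ => EReal.coe_ennreal_nonneg _

theorem riemDist_self (x : M) : riemDist h x x = 0 := by
  refine le_antisymm ?_ (riemDist_nonneg h x x)
  have h1 : IsPiecewiseSmooth n (fun _ : ℝ => x) 0 0 :=
    ⟨0, fun _ => 0, monotone_const, rfl, rfl, fun i hi => absurd hi (Nat.not_lt_zero i)⟩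
  refine (riemDist_le h h1).trans (le_of_eq ?_)
  simp [curveLength]

/-- The segment from `p` to `q` in the chart at `x₀`, parametrized by `[b, b + 1]`. -/
def chartSegment (x₀ : M) (p q : EuclideanSpace ℝ (Fin n)) (b t : ℝ) : M :=
  (extChartAt (𝓡 n) x₀).symm (p + (t - b) • (q - p))

theorem contMDiffOn_chartSegment {x₀ : M} {p q : EuclideanSpace ℝ (Fin n)} {b : ℝ}
    (ht : ∀ t ∈ Icc b (b + 1), p + (t - b) • (q - p) ∈ (extChartAt (𝓡 n) x₀).target) :
    ContMDiffOn 𝓘(ℝ, ℝ) (𝓡 n) ∞ (chartSegment x₀ p q b) (Icc b (b + 1)) := by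
  have h1 : ContDiff ℝ ∞ fun t : ℝ => p + (t - b) • (q - p) := by fun_prop
  exact (contMDiffOn_extChartAt_symm x₀).comp h1.contMDiff.contMDiffOn ht

theorem mfderiv_extChartAt_velocity_chartSegment {x₀ : M} {p q : EuclideanSpace ℝ (Fin n)}
    {b t : ℝ} (ht : p + (t - b) • (q - p) ∈ (extChartAt (𝓡 n) x₀).target) :
    mfderiv (𝓡 n) 𝓘(ℝ, EuclideanSpace ℝ (Fin n)) (extChartAt (𝓡 n) x₀)
      (chartSegment x₀ p q b t) (velocity n (chartSegment x₀ p q b) t) = q - p := by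
  have : IsManifold (𝓡 n) 1 M := IsManifold.of_le (n := ∞) (by simp)
  have h1 : HasDerivAt (fun t : ℝ => p + (t - b) • (q - p)) (q - p) t := by
    simpa using (((hasDerivAt_id t).sub_const b).smul_const (q - p)).const_add p
  have hsymm : MDifferentiableAt 𝓘(ℝ, EuclideanSpace ℝ (Fin n)) (𝓡 n) (extChartAt (𝓡 n) x₀).symm
      (p + (t - b) • (q - p)) := by
    have := mdifferentiableWithinAt_extChartAt_symm (I := 𝓡 n) ht
    rwa [modelWithCornersSelf_coe, range_id, mdifferentiableWithinAt_univ] at this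
  have h2 : MDifferentiableAt 𝓘(ℝ, ℝ) (𝓡 n) (chartSegment x₀ p q b) t :=
    hsymm.comp t h1.differentiableAt.mdifferentiableAt
  have h3 : MDifferentiableAt (𝓡 n) 𝓘(ℝ, EuclideanSpace ℝ (Fin n)) (extChartAt (𝓡 n) x₀)
      (chartSegment x₀ p q b t) := by
    refine mdifferentiableAt_extChartAt ?_
    have := (extChartAt (𝓡 n) x₀).map_target ht
    rwa [extChartAt_source] at this
  have h4 : (extChartAt (𝓡 n) x₀ ∘ chartSegment x₀ p q b) =ᶠ[𝓝 t]
      fun t => p + (t - b) • (q - p) := by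
    filter_upwards [h1.continuousAt.eventually ((isOpen_extChartAt_target x₀).mem_nhds ht)]
      with τ hτ
    exact (extChartAt (𝓡 n) x₀).right_inv hτ
  have h5 := mfderiv_comp t h3 h2
  have h6 : mfderiv 𝓘(ℝ, ℝ) 𝓘(ℝ, EuclideanSpace ℝ (Fin n))
      (extChartAt (𝓡 n) x₀ ∘ chartSegment x₀ p q b) t (1 : ℝ) = q - p := by
    rw [h4.mfderiv_eq, mfderiv_eq_fderiv]
    exact h1.deriv
  rw [h5] at h6
  exact h6

theorem curveLength_chartSegment_le {x₀ : M} {p q : EuclideanSpace ℝ (Fin n)} {b r : ℝ}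
    (ht : ∀ t ∈ Icc b (b + 1), p + (t - b) • (q - p) ∈ (extChartAt (𝓡 n) x₀).target ∧
      ∀ u : TangentSpace (𝓡 n) (chartSegment x₀ p q b t),
        speed h (chartSegment x₀ p q b t) u ≤ r * chartSpeed h x₀
          (mfderiv (𝓡 n) 𝓘(ℝ, EuclideanSpace ℝ (Fin n)) (extChartAt (𝓡 n) x₀)
            (chartSegment x₀ p q b t) u)) :
    curveLength h (chartSegment x₀ p q b) b (b + 1) ≤
      ENNReal.ofReal (r * chartSpeed h x₀ (q - p)) := by
  calc curveLength h (chartSegment x₀ p q b) b (b + 1)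
      ≤ ∫⁻ _ in Icc b (b + 1), ENNReal.ofReal (r * chartSpeed h x₀ (q - p)) := by
        refine setLIntegral_mono' measurableSet_Icc fun t htt => ENNReal.ofReal_le_ofReal ?_
        refine ((ht t htt).2 (velocity n (chartSegment x₀ p q b) t)).trans (le_of_eq ?_)
        exact congrArg (fun z => r * chartSpeed h x₀ z)
          (mfderiv_extChartAt_velocity_chartSegment (ht t htt).1)
    _ = ENNReal.ofReal (r * chartSpeed h x₀ (q - p)) := by simp

/-- The Riemannian distance to a fixed point is almost short in small chart balls. -/
theorem exists_nhds_riemDist_le_add (x x₀ : M) {r : ℝ} (hr : 1 < r) :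
    ∃ s ∈ 𝓝 (extChartAt (𝓡 n) x₀ x₀), ∀ p ∈ s, ∀ q ∈ s,
      riemDist h x ((extChartAt (𝓡 n) x₀).symm q) ≤
        riemDist h x ((extChartAt (𝓡 n) x₀).symm p) +
          ((r * chartSpeed h x₀ (q - p) : ℝ) : EReal) := by
  obtain ⟨δ, hδ, hm⟩ := exists_ball_speed_le h x₀ hr
  refine ⟨_, Metric.ball_mem_nhds _ hδ, fun p hp q hq => ?_⟩
  -- The finite term moves to the left so that the infimum on the right can be tested one curve at a
  -- time.
  rw [← EReal.sub_le_iff_le_add (Or.inl (EReal.coe_ne_bot _)) (Or.inl (EReal.coe_ne_top _))]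
  refine le_iInf fun γ => le_iInf fun a => le_iInf fun b => le_iInf fun hγ =>
    le_iInf fun hx => le_iInf fun hy => ?_
  rw [EReal.sub_le_iff_le_add (Or.inl (EReal.coe_ne_bot _)) (Or.inl (EReal.coe_ne_top _))]
  have hB : ∀ t ∈ Icc b (b + 1), p + (t - b) • (q - p) ∈
      Metric.ball (extChartAt (𝓡 n) x₀ x₀) δ := by
    intro t ht
    have := (convex_ball (extChartAt (𝓡 n) x₀ x₀) δ) hp hq (a := 1 - (t - b)) (b := t - b)
      (by linarith [ht.2]) (by linarith [ht.1]) (by ring)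
    convert this using 1
    module
  have hab : a ≤ b := by
    obtain ⟨N, t, ht, rfl, rfl, -⟩ := hγ
    exact ht (Nat.zero_le N)
  have hbb : b ≤ b + 1 := by linarith
  have hc := contMDiffOn_chartSegment (x₀ := x₀) (p := p) (q := q) (b := b)
    fun t ht => (hm _ (hB t ht)).1
  have hlen := curveLength_chartSegment_le h (x₀ := x₀) (p := p) (q := q) (b := b) (r := r)
    fun t ht => hm _ (hB t ht)
  have hcb : chartSegment x₀ p q b b = γ b := by simp [chartSegment, hy]
  have hdist := riemDist_le h (hγ.ite_le hbb hc hcb)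
  rw [curveLength_add h _ hab hbb,
    curveLength_congr h (γ' := γ) (fun t ht => if_pos ht.2.le),
    curveLength_congr h (γ' := chartSegment x₀ p q b) (fun t ht => if_neg (not_le.2 ht.1)),
    if_pos hab, if_neg (by linarith : ¬ b + 1 ≤ b), hx, EReal.coe_ennreal_add] at hdist
  have hq1 : chartSegment x₀ p q b (b + 1) = (extChartAt (𝓡 n) x₀).symm q := by
    simp [chartSegment]
  rw [hq1] at hdist
  refine hdist.trans (add_le_add le_rfl ?_)
  refine (EReal.coe_ennreal_le_coe_ennreal_iff.2 hlen).trans (le_of_eq ?_)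
  rw [EReal.coe_ennreal_ofReal, max_eq_left]
  exact mul_nonneg (by linarith) (chartSpeed_nonneg h x₀ _)

/-! ### Finiteness, and the distance function as competitor -/

theorem riemDist_ne_top [ConnectedSpace M] (x y : M) : riemDist h x y ≠ ⊤ := by
  have hloc : ∀ x₀ : M, ∃ U ∈ 𝓝 x₀, ∀ y ∈ U, ∀ z ∈ U,
      riemDist h x y ≠ ⊤ → riemDist h x z ≠ ⊤ := by
    intro x₀
    obtain ⟨s, hs, hd⟩ := exists_nhds_riemDist_le_add h x x₀ one_lt_two
    refine ⟨_, inter_mem (extChartAt_source_mem_nhds (I := 𝓡 n) x₀)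
      ((continuousAt_extChartAt (I := 𝓡 n) x₀).preimage_mem_nhds hs), fun y hy z hz hyt hzt => ?_⟩
    have := hd _ hy.2 _ hz.2
    rw [(extChartAt (𝓡 n) x₀).left_inv hy.1, (extChartAt (𝓡 n) x₀).left_inv hz.1, hzt,
      top_le_iff] at this
    exact EReal.add_ne_top hyt (EReal.coe_ne_top _) this
  -- Within each `U` from `hloc`, finiteness at one point forces it at all: this makes the set and
  -- its complement open.
  have hclopen : IsClopen {y | riemDist h x y ≠ ⊤} := by
    refine ⟨⟨isOpen_iff_mem_nhds.2 fun x₀ hx₀ => ?_⟩, isOpen_iff_mem_nhds.2 fun x₀ hx₀ => ?_⟩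
    · obtain ⟨U, hU, hUU⟩ := hloc x₀
      exact mem_of_superset hU fun y hy hyt => hx₀ (hUU y hy x₀ (mem_of_mem_nhds hU) hyt)
    · obtain ⟨U, hU, hUU⟩ := hloc x₀
      exact mem_of_superset hU fun y hy => hUU x₀ (mem_of_mem_nhds hU) y hy hx₀
  have huniv := hclopen.eq_univ ⟨x, by
    rw [mem_ofPred_eq, riemDist_self]
    exact EReal.zero_ne_top⟩
  exact huniv.ge (mem_univ y)

theorem coe_toReal_riemDist [ConnectedSpace M] (x y : M) :
    ((riemDist h x y).toReal : EReal) = riemDist h x y :=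
  EReal.coe_toReal (riemDist_ne_top h x y)
    (ne_bot_of_le_ne_bot EReal.zero_ne_bot (riemDist_nonneg h x y))

theorem isLocallyShort_riemDist [ConnectedSpace M] (x : M) :
    IsLocallyShort h fun y => (riemDist h x y).toReal := by
  intro x₀ r hr
  obtain ⟨s, hs, hd⟩ := exists_nhds_riemDist_le_add h x x₀ hr
  refine ⟨s, hs, fun p hp q hq => ?_⟩
  have := hd p hp q hq
  rw [← coe_toReal_riemDist h x, ← coe_toReal_riemDist h x ((extChartAt (𝓡 n) x₀).symm p),
    ← EReal.coe_add, EReal.coe_le_coe_iff] at this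
  linarith

theorem riemDist_le_lipDist [ConnectedSpace M] (x y : M) : riemDist h x y ≤ lipDist h x y := by
  refine le_trans (le_of_eq ?_) (le_iSup₂ (f := fun (w : M → ℝ) (_ : IsAdmissible h w) =>
    ((w y - w x : ℝ) : EReal)) _ ((isLocallyShort_riemDist h x).isAdmissible h))
  simp only [riemDist_self, EReal.toReal_zero, sub_zero]
  exact (coe_toReal_riemDist h x y).symm

end

end LipschitzDual

end

theorem mainTheorem7 (n : ℕ) (M : Type*) [TopologicalSpace M] [T2Space M]
    [SecondCountableTopology M] [ConnectedSpace M]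
    [ChartedSpace (EuclideanSpace ℝ (Fin n)) M] [IsManifold (𝓡 n) ∞ M]
    (h : LipschitzDual.SmoothMetric n M) :
    ∀ x y : M, LipschitzDual.riemDist h x y = LipschitzDual.lipDist h x y ∧
      LipschitzDual.riemDist h x y ≠ ⊤ :=
  fun x y => ⟨le_antisymm (LipschitzDual.riemDist_le_lipDist h x y)
    (LipschitzDual.lipDist_le_riemDist h x y), LipschitzDual.riemDist_ne_top h x y⟩
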